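/- A partial Steiner triple system (PSTS) is a pair $M=(S,\mathcal L)$, where $S$ is a set of points and $\mathcal L$ is a family of $3$-element subsets of $S$ (lines) such that any two distinct points lie on at most one line. The degree of a point is the number of lines through it; $M$ is connected if $S\neq\emptyset$ and any two points are joined by a finite sequence of points in which consecutive points lie on a common line. $\operatorname{Aut}(M)$ is the group of permutations of $S$ that preserve $\mathcal L$ in both directions. $C_m$ is the cyclic group $\mathbb Z/m$, and $\tau_u\colon i\mapsto i+u$ for $u\in C_m$. The configuration $m$-weaved from $M$, denoted $W_m(M)$, has the point set $S\times C_m$, and its lines are the sets $\{(a,i),(b,j),(c,k)\}$ with $\{a,b,c\}\in\mathcal L$ and $i=j=k-1$ or $i=k=j-1$ or $j=k=i-1$. For an integer $n\ge 3$ and a permutation $\gamma$ of $C_3$, let $\Pi^n_\gamma$ be the configuration with point set $C_3\times C_n$ whose lines are the sets $\{(a,i),(b,i),(c,i+1)\}$ with $\{a,b,c\}=C_3$ and $i=0,\dots,n-2$, and the sets $\{(a,n-1),(b,n-1),(\gamma(c),0)\}$ with $\{a,b,c\}=C_3$. A PSTS contains $\Pi^n_\gamma$ if there is an injective map from the points of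 $\Pi^n_\gamma$ to its points that carries every line to a line. Call $M$ anti-$m$-polypappian if, for every integer $n\ge3$, it contains none of the following: $\Pi^{n}_{\mathrm{id}}$ when $n\mid m$; $\Pi^{n}_{\sigma}$ when $2n\mid m$, where $\sigma(x)=-x$; $\Pi^{n}_{\tau_1}$ when $3n\mid m$. Theorem. Let $m>3$ be an integer and let $M$ be a connected, anti-$m$-polypappian partial Steiner triple system all of whose points have degree $>1$. Then $$\operatorname{Aut}(W_m(M))=\{\,f\times\tau_u : f\in\operatorname{Aut}(M),\ u\in C_m\,\},\qquad (f\times\tau_u)(a,i)=(f(a),i+u).$$ Consequently $\operatorname{Aut}(W_m(M))\cong\operatorname{Aut}(M)\oplus C_m$. -/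

import Mathlib

namespace Weaving

/-- A point-line structure on the point set `S`: a family of lines, each a set of points. -/
@[ext]
structure PointLineStructure (S : Type*) where
  lines : Set (Set S)

namespace PointLineStructure

variable {S : Type*} {P : Type*}

/-- Partial Steiner triple systems: every line has exactly three points, and two distinct points
lie on at most one common line. -/
structure IsPSTS (M : PointLineStructure S) : Prop where
  card_line : ∀ L ∈ M.lines, L.encard = 3
  line_unique : ∀ p q : S, p ≠ q → ∀ L ∈ M.lines, ∀ K ∈ M.lines,
    p ∈ L → q ∈ L → p ∈ K → q ∈ K → L = K

/-- The degree of a point: the number of lines through it. -/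
noncomputable def degree (M : PointLineStructure S) (p : S) : ℕ∞ :=
  {L ∈ M.lines | p ∈ L}.encard

/-- The collinearity graph: distinct points are adjacent when some line contains both. -/
def collinearityGraph (M : PointLineStructure S) : SimpleGraph S where
  Adj p q := p ≠ q ∧ ∃ L ∈ M.lines, p ∈ L ∧ q ∈ L
  symm := ⟨fun _ _ h => ⟨h.1.symm, h.2.imp fun _ hL => ⟨hL.1, hL.2.2, hL.2.1⟩⟩⟩
  loopless := ⟨fun _ h => h.1 rfl⟩

/-- `M` is connected: it has a point, and any two points are joined by a path of successively
collinear points. -/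
def IsConnected (M : PointLineStructure S) : Prop :=
  M.collinearityGraph.Connected

/-- The automorphism group: the permutations of the points that preserve the family of lines in
both directions. -/
def Aut (M : PointLineStructure S) : Subgroup (Equiv.Perm S) where
  carrier := {f | ∀ L : Set S, f '' L ∈ M.lines ↔ L ∈ M.lines}
  one_mem' := by intro L; simp
  mul_mem' := by
    intro f g hf hg L
    rw [Equiv.Perm.coe_mul, Set.image_comp]
    exact (hf _).trans (hg _)
  inv_mem' := by
    intro f hf L
    have h := hf ((f⁻¹ : Equiv.Perm S) '' L)
    rw [← Set.image_comp, ← Equiv.Perm.coe_mul, mul_inv_cancel] at h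
    simpa using h.symm

/-- `M` contains the configuration `K` (as a subconfiguration): the points of `K` can be mapped
injectively to points of `M` so that every line of `K` becomes a line of `M`. -/
def Contains (M : PointLineStructure S) (K : PointLineStructure P) : Prop :=
  ∃ φ : P → S, Function.Injective φ ∧ ∀ L ∈ K.lines, φ '' L ∈ M.lines

/-- The weights allowed on the lines of a weaved configuration. -/
def weights (m : ℕ) : Set (ZMod m × ZMod m × ZMod m) :=
  {(i, j, k) | (i = j ∧ j = k - 1) ∨ (i = k ∧ k = j - 1) ∨ (j = k ∧ k = i - 1)}

/-- The configuration `m`-weaved from `M`. -/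
def weave (m : ℕ) (M : PointLineStructure S) : PointLineStructure (S × ZMod m) where
  lines := {K | ∃ a b c : S, ∃ i j k : ZMod m,
    ({a, b, c} : Set S) ∈ M.lines ∧ (i, j, k) ∈ weights m ∧ K = {(a, i), (b, j), (c, k)}}

/-- The configuration of `n` triangles, each inscribed into the previous one, the first one being
inscribed into the last one by means of the permutation `γ` of its vertices. -/
def cyclicTriangles (n : ℕ) (γ : Equiv.Perm (ZMod 3)) :
    PointLineStructure (ZMod 3 × ZMod n) where
  lines :=
    {K | ∃ a b c : ZMod 3, ({a, b, c} : Set (ZMod 3)) = Set.univ ∧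
      ((∃ i : ℕ, i + 1 < n ∧
          K = {(a, (i : ZMod n)), (b, (i : ZMod n)), (c, ((i + 1 : ℕ) : ZMod n))}) ∨
        K = {(a, ((n - 1 : ℕ) : ZMod n)), (b, ((n - 1 : ℕ) : ZMod n)), (γ c, 0)})}

/-- `M` is anti-`m`-polypappian. -/
def IsAntiPolypappian (m : ℕ) (M : PointLineStructure S) : Prop :=
  ∀ n : ℕ, 3 ≤ n →
    (n ∣ m → ¬ M.Contains (cyclicTriangles n 1)) ∧
    (2 * n ∣ m → ¬ M.Contains (cyclicTriangles n (Equiv.neg (ZMod 3)))) ∧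
    (3 * n ∣ m → ¬ M.Contains (cyclicTriangles n (Equiv.addRight (1 : ZMod 3))))

end PointLineStructure

end Weaving

namespace Weaving

namespace PointLineStructure

/-! Let F be an automorphism of the weaved configuration. Along a line of M, the levels of the
images of the three fibres satisfy weight conditions so rigid that, for m > 3, either all levels
shift together or each fibre lands in one level (`levels_alternative`); connectedness makes the
choice global.

In the second case F⁻¹ has the same form, and the first coordinates of the images of the m copies of
a line trace Π^m_id in M (`not_aut_fibre_to_level`).

In the first case F(x, i) = (f_i x, u + i). Put D_i = f_{i+1} f_i⁻¹. Each D_i is a shear, and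
D_{i+1} = D_i⁻², so every f_k is a power of D_0 times f_0. A shear with a fixed point is trivial,
and no shear moves a point to one collinear with it. Hence, if the least period n of i ↦ f_i is at
least 3, the images of one line under the f_i form Π^n_id with n ∣ m, which is excluded; a shorter
period forces f to be constant (`levels_constant`). -/

/-- The points `a`, `b`, `c` form a line. -/
def IsLine {S : Type*} (M : PointLineStructure S) (a b c : S) : Prop :=
  ({a, b, c} : Set S) ∈ M.lines

/-! ### Lines, third points and automorphisms -/

section Lines

variable {S : Type*} {M : PointLineStructure S}

lemma IsLine.swap {a b c : S} (h : M.IsLine a b c) : M.IsLine b a c := by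
  unfold IsLine at *
  rwa [Set.insert_comm]

lemma IsLine.rotate {a b c : S} (h : M.IsLine a b c) : M.IsLine b c a := by
  unfold IsLine at *
  rwa [Set.insert_comm, Set.pair_comm a c] at h

lemma IsLine.swap_right {a b c : S} (h : M.IsLine a b c) : M.IsLine a c b :=
  h.rotate.swap.rotate.rotate

lemma IsPSTS.ne (hM : M.IsPSTS) {a b c : S} (h : M.IsLine a b c) : a ≠ b := by
  rintro rfl
  have h3 := hM.card_line _ h
  rw [Set.insert_eq_of_mem (Set.mem_insert a {c})] at h3
  have h2 := Set.encard_insert_le {c} a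
  rw [Set.encard_singleton] at h2
  rw [h3] at h2
  exact absurd h2 (by norm_num)

lemma IsPSTS.third_unique (hM : M.IsPSTS) {a b c d : S} (h : M.IsLine a b c)
    (h' : M.IsLine a b d) : c = d := by
  have hE := hM.line_unique a b (hM.ne h) _ h _ h' (by simp) (by simp) (by simp) (by simp)
  have hc : c ∈ ({a, b, d} : Set S) := hE ▸ (by simp)
  rcases hc with hc | hc | hc
  · exact absurd hc.symm (hM.ne h.swap_right)
  · exact absurd hc.symm (hM.ne h.rotate)
  · exact hc

lemma IsPSTS.exists_isLine_of_mem (hM : M.IsPSTS) {L : Set S} (hL : L ∈ M.lines) {p q : S}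
    (hp : p ∈ L) (hq : q ∈ L) (hpq : p ≠ q) : ∃ r, M.IsLine p q r := by
  obtain ⟨x, y, z, -, -, -, rfl⟩ := Set.encard_eq_three.1 (hM.card_line L hL)
  have h : M.IsLine x y z := hL
  rcases hp with rfl | rfl | rfl <;> rcases hq with rfl | rfl | rfl
  all_goals first
    | exact absurd rfl hpq
    | exact ⟨_, h⟩
    | exact ⟨_, h.swap⟩
    | exact ⟨_, h.rotate⟩
    | exact ⟨_, h.rotate.rotate⟩
    | exact ⟨_, h.swap_right⟩
    | exact ⟨_, h.rotate.swap⟩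

lemma IsPSTS.exists_isLine (hM : M.IsPSTS) (hdeg : ∀ p : S, 1 < M.degree p) (p : S) :
    ∃ q r, M.IsLine p q r := by
  have h0 : {L ∈ M.lines | p ∈ L}.encard ≠ 0 := fun h => by
    have := hdeg p
    rw [degree, h] at this
    exact absurd this (by simp)
  obtain ⟨L, hL, hp⟩ := Set.encard_ne_zero.1 h0
  obtain ⟨x, y, z, hxy, hxz, hyz, rfl⟩ := Set.encard_eq_three.1 (hM.card_line L hL)
  by_cases hpx : p = x
  · subst hpx
    exact ⟨y, z, hL⟩
  · exact ⟨x, hM.exists_isLine_of_mem hL hp (by simp) hpx⟩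

/-- A property that spreads along lines and holds at one point of a connected structure holds
everywhere. -/
lemma IsPSTS.induction_isLine (hM : M.IsPSTS) (hconn : M.IsConnected) {P : S → Prop}
    (hP : ∀ a b c, M.IsLine a b c → P a → P b) {x : S} (hx : P x) (y : S) : P y := by
  obtain ⟨w⟩ := hconn.preconnected x y
  induction w with
  | nil => exact hx
  | cons hadj _ ih =>
    obtain ⟨hne, L, hL, h1, h2⟩ := hadj
    obtain ⟨r, hr⟩ := hM.exists_isLine_of_mem hL h1 h2 hne
    exact ih (hP _ _ _ hr hx)

lemma mem_aut_iff (hM : ∀ L ∈ M.lines, ∃ a b c, L = {a, b, c}) (F : Equiv.Perm S) :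
    F ∈ M.Aut ↔ ∀ a b c, M.IsLine (F a) (F b) (F c) ↔ M.IsLine a b c := by
  constructor
  · intro h a b c
    have := h {a, b, c}
    rwa [Set.image_insert_eq, Set.image_pair] at this
  · intro h L
    constructor
    · intro hL
      obtain ⟨a, b, c, hE⟩ := hM _ hL
      have hE' : L = {F.symm a, F.symm b, F.symm c} := by
        rw [← Set.image_pair, ← Set.image_insert_eq, ← hE, Equiv.symm_image_image]
      rw [hE']
      refine (h _ _ _).1 ?_
      simp only [Equiv.apply_symm_apply, IsLine]
      rwa [← hE]
    · intro hL
      obtain ⟨a, b, c, rfl⟩ := hM _ hL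
      rw [Set.image_insert_eq, Set.image_pair]
      exact (h a b c).2 hL

lemma IsPSTS.mem_aut_iff (hM : M.IsPSTS) (F : Equiv.Perm S) :
    F ∈ M.Aut ↔ ∀ a b c, M.IsLine (F a) (F b) (F c) ↔ M.IsLine a b c := by
  refine PointLineStructure.mem_aut_iff (fun L hL => ?_) F
  obtain ⟨x, y, z, -, -, -, h⟩ := Set.encard_eq_three.1 (hM.card_line L hL)
  exact ⟨x, y, z, h⟩

end Lines

/-! ### Cycles of inscribed triangles -/

section CyclicTriangles

variable {S : Type*} {M : PointLineStructure S}

lemma exists_triangle_eq_univ : ∀ x y : ZMod 3, x ≠ y →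
    ∃ z : ZMod 3, ({x, y, z} : Set (ZMod 3)) = Set.univ := by
  have h : ∀ x y : ZMod 3, x ≠ y → ∃ z : ZMod 3, ∀ t, t = x ∨ t = y ∨ t = z := by decide
  intro x y hxy
  obtain ⟨z, hz⟩ := h x y hxy
  exact ⟨z, Set.eq_univ_of_forall hz⟩

/-- The points of a line can be indexed by `C_3`. -/
lemma IsLine.exists_param {a b c : S} (h : M.IsLine a b c) :
    ∃ l : ZMod 3 → S, ∀ x y z : ZMod 3, ({x, y, z} : Set (ZMod 3)) = Set.univ →
      M.IsLine (l x) (l y) (l z) := by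
  obtain ⟨l, hl⟩ : ∃ l : ZMod 3 → S, Set.range l = {a, b, c} := by
    refine ⟨(![a, b, c] : Fin 3 → S), ?_⟩
    have : Set.range (![a, b, c] : Fin 3 → S) = {a, b, c} := by
      simp only [Matrix.range_cons, Matrix.range_empty, Set.union_empty, Set.singleton_union]
    exact this
  refine ⟨l, fun x y z hxyz => ?_⟩
  unfold IsLine at *
  rwa [← Set.image_pair, ← Set.image_insert_eq, hxyz, Set.image_univ, hl]

/-- With trivial γ the closing inscription looks like all the others, so one condition indexed
cyclically covers both kinds of lines. -/
lemma contains_cyclicTriangles {n : ℕ} (hn : 0 < n) (φ : ZMod 3 × ZMod n → S)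
    (hφ : Function.Injective φ)
    (h : ∀ (i : ZMod n) (a b c : ZMod 3), ({a, b, c} : Set (ZMod 3)) = Set.univ →
      M.IsLine (φ (a, i)) (φ (b, i)) (φ (c, i + 1))) :
    M.Contains (cyclicTriangles n 1) := by
  refine ⟨φ, hφ, ?_⟩
  rintro K ⟨a, b, c, habc, ⟨i, -, rfl⟩ | rfl⟩
  · rw [Set.image_insert_eq, Set.image_pair, Nat.cast_succ]
    exact h _ a b c habc
  · rw [Set.image_insert_eq, Set.image_pair]
    have h0 : (((n - 1 : ℕ) : ZMod n)) + 1 = 0 := by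
      rw [← Nat.cast_succ, Nat.succ_eq_add_one, Nat.sub_add_cancel hn, ZMod.natCast_self]
    have := h ((n - 1 : ℕ) : ZMod n) a b c habc
    rwa [h0] at this

end CyclicTriangles

/-! ### Shears -/

section Shears

variable {S : Type*} {M : PointLineStructure S}

/-- Permutations `E` such that every line stays a line when `E` is applied to one of its points
and `E⁻¹` to another one. -/
def IsShear (M : PointLineStructure S) (E : Equiv.Perm S) : Prop :=
  ∀ x y z, M.IsLine x y z → M.IsLine x (E y) (E⁻¹ z)

lemma IsShear.inv {E : Equiv.Perm S} (h : M.IsShear E) : M.IsShear E⁻¹ := by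
  intro x y z hl
  rw [inv_inv]
  exact (h x z y hl.swap_right).swap_right

lemma IsShear.pow {E : Equiv.Perm S} (h : M.IsShear E) (k : ℕ) : M.IsShear (E ^ k) := by
  induction k with
  | zero => intro x y z hl; simpa using hl
  | succ k ih =>
    intro x y z hl
    have := ih _ _ _ (h x y z hl)
    rwa [← Equiv.Perm.mul_apply, ← Equiv.Perm.mul_apply, ← pow_succ, ← mul_inv_rev,
      ← pow_succ'] at this

lemma IsShear.zpow {E : Equiv.Perm S} (h : M.IsShear E) (k : ℤ) : M.IsShear (E ^ k) := by
  obtain ⟨k, rfl | rfl⟩ := k.eq_nat_or_neg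
  · rw [zpow_natCast]
    exact h.pow k
  · rw [zpow_neg, zpow_natCast]
    exact (h.pow k).inv

/-- Fixed points spread along lines: if `a` is fixed and {a, b, c} is a line, the shear keeps `c`
and `a`, hence also the third point `b`. -/
lemma IsShear.eq_one (hM : M.IsPSTS) (hconn : M.IsConnected) {E : Equiv.Perm S}
    (h : M.IsShear E) {y : S} (hy : E y = y) : E = 1 := by
  ext z
  refine hM.induction_isLine hconn (P := fun z => E z = z) ?_ hy z
  intro a b c hl ha
  have h1 := h c a b hl.rotate.rotate
  rw [ha] at h1
  have h2 := hM.third_unique h1 hl.rotate.rotate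
  exact (Equiv.Perm.inv_eq_iff_eq.1 h2).symm

lemma IsShear.ne (hM : M.IsPSTS) {E : Equiv.Perm S} (h : M.IsShear E) {x y z : S}
    (hl : M.IsLine x y z) : x ≠ E y :=
  hM.ne (h x y z hl)

end Shears

/-! ### Automorphisms that shift levels -/

section LevelPreserving

variable {S : Type*} {M : PointLineStructure S} {m : ℕ} {f : ZMod m → Equiv.Perm S}

/-- Pull a line back with `z` as the point on the higher level, then push it forward with `y` in
that role. -/
lemma isShear_succ_mul_inv
    (hf : ∀ i a b c, M.IsLine (f i a) (f i b) (f (i + 1) c) ↔ M.IsLine a b c) (i : ZMod m) :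
    M.IsShear (f (i + 1) * (f i)⁻¹) := by
  intro x y z hl
  have h1 : M.IsLine ((f i)⁻¹ x) ((f i)⁻¹ y) ((f (i + 1))⁻¹ z) := by
    rw [← hf i]
    simpa using hl
  have h2 := (hf i _ _ _).2 h1.swap_right
  simpa using h2.swap_right

/-- Shearing a line twice applies D to `x` and `y` and D⁻² to `z`; passing from level i to i + 1
gives the same first two points, so the third points agree. -/
lemma succ_mul_inv_recurrence (hM : M.IsPSTS) (hex : ∀ p, ∃ q r, M.IsLine p q r)
    (hf : ∀ i a b c, M.IsLine (f i a) (f i b) (f (i + 1) c) ↔ M.IsLine a b c) (i : ZMod m) :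
    f (i + 1 + 1) * (f (i + 1))⁻¹ = (f (i + 1) * (f i)⁻¹)⁻¹ * (f (i + 1) * (f i)⁻¹)⁻¹ := by
  ext z
  obtain ⟨x, y, hl⟩ := hex z
  replace hl := hl.rotate
  have hD := isShear_succ_mul_inv hf i
  have h1 := (hD _ _ _ (hD _ _ _ hl).swap).swap
  have h2 : M.IsLine ((f i)⁻¹ x) ((f i)⁻¹ y) ((f (i + 1))⁻¹ z) := by
    rw [← hf i]
    simpa using hl
  have h3 := (hf (i + 1) _ _ _).2 h2
  refine hM.third_unique (a := (f (i + 1) * (f i)⁻¹) x) (b := (f (i + 1) * (f i)⁻¹) y) ?_ ?_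
  · simpa using h3
  · simpa using h1

lemma exists_zpow_mul (hM : M.IsPSTS) (hex : ∀ p, ∃ q r, M.IsLine p q r)
    (hf : ∀ i a b c, M.IsLine (f i a) (f i b) (f (i + 1) c) ↔ M.IsLine a b c) (k : ℕ) :
    ∃ s : ℤ, f k = (f (0 + 1) * (f 0)⁻¹) ^ s * f 0 := by
  set D := f (0 + 1) * (f 0)⁻¹ with hD
  suffices h : ∃ s t : ℤ, f k = D ^ s * f 0 ∧ f (k + 1) * (f k)⁻¹ = D ^ t from
    ⟨h.choose, h.choose_spec.choose_spec.1⟩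
  induction k with
  | zero => exact ⟨0, 1, by simp, by simp [hD]⟩
  | succ k ih =>
    obtain ⟨s, t, h1, h2⟩ := ih
    refine ⟨t + s, -t + -t, ?_, ?_⟩
    · rw [Nat.cast_succ, zpow_add, mul_assoc, ← h1, ← h2, inv_mul_cancel_right]
    · rw [Nat.cast_succ, succ_mul_inv_recurrence hM hex hf, h2, zpow_add, zpow_neg]

/-- A level preserving automorphism of the weaved configuration acts in the same way on all
levels, unless a cycle of inscribed triangles is contained in `M`. -/
lemma levels_constant (hm : 3 < m) (hM : M.IsPSTS) (hconn : M.IsConnected)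
    (hex : ∀ p, ∃ q r, M.IsLine p q r) (hanti : M.IsAntiPolypappian m)
    (hf : ∀ i a b c, M.IsLine (f i a) (f i b) (f (i + 1) c) ↔ M.IsLine a b c) (i : ZMod m) :
    f i = f 0 := by
  have : NeZero m := ⟨by omega⟩
  -- Each f_{i+1} is determined by f_i, as the third point of a line is determined by the other two.
  have hstep : ∀ i j : ZMod m, f i = f j → f (i + 1) = f (j + 1) := by
    intro i j h
    ext c
    obtain ⟨a, b, hl⟩ := hex c
    have h1 := (hf i _ _ _).2 hl.rotate
    have h2 := (hf j _ _ _).2 hl.rotate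
    rw [h] at h1
    exact hM.third_unique h1 h2
  have hsteps : ∀ (k : ℕ) (i j : ZMod m), f i = f j → f (i + k) = f (j + k) := by
    intro k
    induction k with
    | zero => intro i j h; simpa using h
    | succ k ih =>
      intro i j h
      rw [Nat.cast_succ, ← add_assoc, ← add_assoc]
      exact hstep _ _ (ih _ _ h)
  have hexn : ∃ n : ℕ, 0 < n ∧ f n = f 0 := ⟨m, by omega, by rw [ZMod.natCast_self]⟩
  classical
  set n := Nat.find hexn with hn
  obtain ⟨hn0, hfn⟩ := Nat.find_spec hexn
  rw [← hn] at hn0 hfn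
  have hmin : ∀ k : ℕ, k < n → f k = f 0 → k = 0 := by
    intro k hk h
    by_contra hk0
    exact Nat.find_min hexn hk ⟨Nat.pos_of_ne_zero hk0, h⟩
  have hmul : ∀ (q r : ℕ), f ((n * q + r : ℕ) : ZMod m) = f r := by
    intro q r
    induction q with
    | zero => simp
    | succ q ih =>
      rw [← ih]
      have := hsteps (n * q + r) _ _ hfn
      rw [zero_add, ← Nat.cast_add] at this
      rw [← this]
      congr 2
      ring
  have hmod : ∀ k : ℕ, f k = f (k % n : ℕ) := by
    intro k
    conv_lhs => rw [← Nat.div_add_mod k n]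
    exact hmul _ _
  have hnm : n ∣ m := by
    refine Nat.dvd_of_mod_eq_zero (hmin _ (Nat.mod_lt _ hn0) ?_)
    rw [← hmod, ZMod.natCast_self]
  have hnlem : n ≤ m := Nat.le_of_dvd (by omega) hnm
  -- Adding m - i to both indices brings the first back to 0, and minimality of n applies to j - i.
  have hinj : ∀ i j : ℕ, i ≤ j → j < n → f i = f j → i = j := by
    intro i j hij hj h
    have h1 := hsteps (m - i) _ _ h
    rw [← Nat.cast_add, ← Nat.cast_add, Nat.add_sub_cancel' (by omega),
      show j + (m - i) = (j - i) + m by omega, Nat.cast_add, ZMod.natCast_self, add_zero] at h1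
    have := hmin (j - i) (by omega) h1.symm
    omega
  by_cases hn3 : 3 ≤ n
  · refine absurd ?_ ((hanti n hn3).1 hnm)
    have : NeZero n := ⟨by omega⟩
    obtain ⟨p⟩ := hconn.nonempty
    obtain ⟨q, r, hl⟩ := hex p
    obtain ⟨l, hl⟩ := hl.exists_param
    refine contains_cyclicTriangles hn0 (fun p => f (p.2.val : ZMod m) (l p.1)) ?_ ?_
    · rintro ⟨x, i⟩ ⟨y, j⟩ h
      simp only at h
      obtain ⟨s, hs⟩ := exists_zpow_mul hM hex hf i.val
      obtain ⟨t, ht⟩ := exists_zpow_mul hM hex hf j.val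
      set D := f (0 + 1) * (f 0)⁻¹ with hD
      have hsh : M.IsShear D := isShear_succ_mul_inv hf 0
      have hxy : f 0 (l x) = (D ^ (-s + t)) (f 0 (l y)) := by
        rw [hs, ht, Equiv.Perm.mul_apply, Equiv.Perm.mul_apply] at h
        rw [zpow_add, Equiv.Perm.mul_apply, ← h, ← Equiv.Perm.mul_apply, ← zpow_add]
        simp
      by_cases hne : x = y
      · subst hne
        have h1 := (hsh.zpow (-s + t)).eq_one hM hconn hxy.symm
        have hst : D ^ s = D ^ t := by
          rw [zpow_add, zpow_neg, inv_mul_eq_one] at h1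
          exact h1
        have hij : f (i.val : ZMod m) = f (j.val : ZMod m) := by rw [hs, ht, hst]
        have : i.val = j.val := by
          rcases le_total i.val j.val with hle | hle
          · exact hinj _ _ hle (ZMod.val_lt j) hij
          · exact (hinj _ _ hle (ZMod.val_lt i) hij.symm).symm
        rw [ZMod.val_injective n this]
      · obtain ⟨z, hz⟩ := exists_triangle_eq_univ x y hne
        exact absurd hxy ((hsh.zpow _).ne hM ((hf 0 _ _ _).2 (hl x y z hz)))
    · intro i a b c habc
      have h1 : f ((i + 1).val : ZMod m) = f ((i.val : ZMod m) + 1) := by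
        rw [← Nat.cast_succ, hmod i.val.succ, ← ZMod.val_natCast, Nat.cast_succ,
          ZMod.natCast_zmod_val]
      simp only [h1]
      exact (hf _ _ _ _).2 (hl a b c habc)
  · have hone : f (0 + 1) = f 0 := by
      have h12 : n = 1 ∨ n = 2 := by omega
      rcases h12 with h1 | h2
      · rw [h1] at hfn
        simpa using hfn
      · rw [h2] at hfn
        have h20 : f (0 + 1 + 1) = f 0 := by
          rw [← hfn]
          congr 1
          push_cast
          ring
        -- For period 2, the images of `a` on levels 0 and 1 both complete f_1 b, f_0 c to a line.
        ext a
        obtain ⟨b, c, hl⟩ := hex a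
        have h1 := ((hf 0 _ _ _).2 hl.swap_right).swap_right
        have h2 := (hf (0 + 1) _ _ _).2 hl
        rw [h20] at h2
        exact hM.third_unique h2.rotate h1.rotate
    have hall : ∀ k : ℕ, f k = f 0 := by
      intro k
      induction k with
      | zero => simp
      | succ k ih =>
        rw [Nat.cast_succ, ← hone]
        exact hstep _ _ ih
    have := hall i.val
    rwa [ZMod.natCast_zmod_val] at this

end LevelPreserving

/-! ### Lines and automorphisms of the weaved configuration -/

section Weave

variable {S : Type*} {M : PointLineStructure S} {m : ℕ}

lemma isLine_weave_of_mem {p q r : S × ZMod m} (h : M.IsLine p.1 q.1 r.1)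
    (hw : (p.2, q.2, r.2) ∈ weights m) : (M.weave m).IsLine p q r :=
  ⟨p.1, q.1, r.1, p.2, q.2, r.2, h, hw, rfl⟩

lemma IsPSTS.isLine_weave_iff (hM : M.IsPSTS) {p q r : S × ZMod m} :
    (M.weave m).IsLine p q r ↔ M.IsLine p.1 q.1 r.1 ∧ (p.2, q.2, r.2) ∈ weights m := by
  refine ⟨?_, fun h => isLine_weave_of_mem h.1 h.2⟩
  rintro ⟨a, b, c, i, j, k, hl, hw, hE⟩
  have h1 : M.IsLine p.1 q.1 r.1 := by
    have := congrArg (Set.image Prod.fst) hE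
    simp only [Set.image_insert_eq, Set.image_singleton] at this
    unfold IsLine
    rwa [this]
  refine ⟨h1, ?_⟩
  have hpq := hM.ne h1
  have hqr := hM.ne h1.rotate
  have hpr := hM.ne h1.swap_right
  have hp : p ∈ ({(a, i), (b, j), (c, k)} : Set (S × ZMod m)) := hE ▸ (by simp)
  have hq : q ∈ ({(a, i), (b, j), (c, k)} : Set (S × ZMod m)) := hE ▸ (by simp)
  have hr : r ∈ ({(a, i), (b, j), (c, k)} : Set (S × ZMod m)) := hE ▸ (by simp)
  simp only [weights, Set.mem_ofPred_eq] at hw ⊢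
  rcases hp with rfl | rfl | rfl <;> rcases hq with rfl | rfl | rfl <;>
    rcases hr with rfl | rfl | rfl <;> first
    | exact absurd rfl hpq
    | exact absurd rfl hqr
    | exact absurd rfl hpr
    | (rcases hw with hw | hw | hw <;> obtain ⟨rfl, h⟩ := hw <;> simp [h])

lemma weave_mem_aut_iff (F : Equiv.Perm (S × ZMod m)) :
    F ∈ (M.weave m).Aut ↔
      ∀ p q r, (M.weave m).IsLine (F p) (F q) (F r) ↔ (M.weave m).IsLine p q r := by
  refine mem_aut_iff ?_ F
  rintro K ⟨a, b, c, i, j, k, -, -, rfl⟩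
  exact ⟨_, _, _, rfl⟩

lemma prodCongr_mem_aut (hM : M.IsPSTS) {f : Equiv.Perm S} (hf : f ∈ M.Aut) (u : ZMod m) :
    (Equiv.prodCongr f (Equiv.addRight u) : Equiv.Perm (S × ZMod m)) ∈ (M.weave m).Aut := by
  rw [weave_mem_aut_iff]
  rw [hM.mem_aut_iff] at hf
  intro p q r
  rw [hM.isLine_weave_iff, hM.isLine_weave_iff]
  simp [weights, hf, add_sub_right_comm]

lemma natCast_ne_zero_of_lt {k : ℕ} (hk : 0 < k) (hkm : k < m) : (k : ZMod m) ≠ 0 := by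
  rw [Ne, ZMod.natCast_eq_zero_iff]
  exact Nat.not_dvd_of_pos_of_lt hk hkm

/-- Primes mark successive indices. Besides the two outcomes, `h1`, `h2`, `h3` allow two equal
levels with the third one lower; then two of the primed levels differ by 2, which `k2` or `k3`
forbids as m > 3. -/
lemma levels_step (hm : 3 < m) {a b c a' b' c' b'' c'' : ZMod m}
    (h1 : (a', b, c) ∈ weights m) (h2 : (a, b', c) ∈ weights m) (h3 : (a, b, c') ∈ weights m)
    (k2 : (a', b'', c') ∈ weights m) (k3 : (a', b', c'') ∈ weights m) :
    (a = b ∧ a = c ∧ a' = a + 1 ∧ b' = a + 1 ∧ c' = a + 1) ∨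
      ((a, b, c) ∈ weights m ∧ a' = a ∧ b' = b ∧ c' = c) := by
  have e1 : (1 : ZMod m) ≠ 0 := by
    exact_mod_cast natCast_ne_zero_of_lt (m := m) (k := 1) (by omega) (by omega)
  have e2 : (2 : ZMod m) ≠ 0 := by
    exact_mod_cast natCast_ne_zero_of_lt (m := m) (k := 2) (by omega) (by omega)
  have e3 : (3 : ZMod m) ≠ 0 := by
    exact_mod_cast natCast_ne_zero_of_lt (m := m) (k := 3) (by omega) (by omega)
  simp only [weights, Set.mem_ofPred_eq] at *
  rcases h1 with h1 | h1 | h1 <;> rcases h2 with h2 | h2 | h2 <;> rcases h3 with h3 | h3 | h3 <;>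
    grind

lemma levels_alternative (hm : 3 < m) {A B C : ZMod m → ZMod m}
    (hA : ∀ i, (A (i + 1), B i, C i) ∈ weights m) (hB : ∀ i, (A i, B (i + 1), C i) ∈ weights m)
    (hC : ∀ i, (A i, B i, C (i + 1)) ∈ weights m) :
    (∀ i, A i = A 0 + i ∧ B i = A 0 + i) ∨ (∀ i, A i = A 0 ∧ B i = B 0) := by
  have : NeZero m := ⟨by omega⟩
  have e1 : (1 : ZMod m) ≠ 0 := by
    exact_mod_cast natCast_ne_zero_of_lt (m := m) (k := 1) (by omega) (by omega)
  have step : ∀ i, _ := fun i => levels_step hm (hA i) (hB i) (hC i) (hB (i + 1)) (hC (i + 1))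
  -- Constant triples are not weights, so the outcome at index 0 persists at all later ones.
  have hw : ∀ a : ZMod m, (a, a, a) ∉ weights m := by
    intro a h
    simp [weights, eq_sub_iff_add_eq, e1] at h
  by_cases h0 : (A 0, B 0, C 0) ∈ weights m
  · right
    have hall : ∀ k : ℕ, A k = A 0 ∧ B k = B 0 ∧ C k = C 0 := by
      intro k
      induction k with
      | zero => simp
      | succ k ih =>
        obtain ⟨ha, hb, hc⟩ := ih
        rw [Nat.cast_succ]
        rcases step k with ⟨h1, h2, -⟩ | ⟨-, h1, h2, h3⟩
        · rw [ha, hb] at h1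
          rw [ha, hc] at h2
          rw [← h1, ← h2] at h0
          exact absurd h0 (hw _)
        · exact ⟨h1.trans ha, h2.trans hb, h3.trans hc⟩
    intro i
    have := hall i.val
    rw [ZMod.natCast_zmod_val] at this
    exact ⟨this.1, this.2.1⟩
  · left
    have h00 : A 0 = B 0 ∧ A 0 = C 0 := by
      rcases step 0 with ⟨h1, h2, -⟩ | ⟨h1, -⟩
      · exact ⟨h1, h2⟩
      · exact absurd h1 h0
    have hall : ∀ k : ℕ, A k = A 0 + k ∧ B k = A 0 + k ∧ C k = A 0 + k := by
      intro k
      induction k with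
      | zero => simp [← h00.1, ← h00.2]
      | succ k ih =>
        obtain ⟨ha, hb, hc⟩ := ih
        rw [Nat.cast_succ]
        rcases step k with ⟨-, -, h1, h2, h3⟩ | ⟨h1, -⟩
        · rw [h1, h2, h3, ha, add_assoc]
          exact ⟨rfl, rfl, rfl⟩
        · rw [ha, hb, hc] at h1
          exact absurd h1 (hw _)
    intro i
    have := hall i.val
    rw [ZMod.natCast_zmod_val] at this
    exact ⟨this.1, this.2.1⟩

/-- An automorphism of the weaved configuration either shifts all levels by the same amount or
maps every fibre into one level. -/
lemma aut_level_alternative (hm : 3 < m) (hM : M.IsPSTS) (hconn : M.IsConnected)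
    (hex : ∀ p, ∃ q r, M.IsLine p q r) {F : Equiv.Perm (S × ZMod m)} (hF : F ∈ (M.weave m).Aut) :
    (∃ u : ZMod m, ∀ x i, (F (x, i)).2 = u + i) ∨ (∀ x i, (F (x, i)).2 = (F (x, 0)).2) := by
  have e1 : (1 : ZMod m) ≠ 0 := by
    exact_mod_cast natCast_ne_zero_of_lt (m := m) (k := 1) (by omega) (by omega)
  rw [weave_mem_aut_iff] at hF
  have key : ∀ a b c, M.IsLine a b c →
      (∀ i, (F (a, i)).2 = (F (a, 0)).2 + i ∧ (F (b, i)).2 = (F (a, 0)).2 + i) ∨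
        (∀ i, (F (a, i)).2 = (F (a, 0)).2 ∧ (F (b, i)).2 = (F (b, 0)).2) := by
    intro a b c hl
    have hw : ∀ i j k : ZMod m, (i, j, k) ∈ weights m →
        ((F (a, i)).2, (F (b, j)).2, (F (c, k)).2) ∈ weights m := fun i j k h =>
      (hM.isLine_weave_iff.1 ((hF _ _ _).2
        (isLine_weave_of_mem (p := (a, i)) (q := (b, j)) (r := (c, k)) hl h))).2
    exact levels_alternative hm (C := fun i => (F (c, i)).2)
      (fun i => hw _ _ _ (by simp [weights])) (fun i => hw _ _ _ (by simp [weights]))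
      (fun i => hw _ _ _ (by simp [weights]))
  obtain ⟨p⟩ := hconn.nonempty
  obtain ⟨q, r, hl⟩ := hex p
  rcases key p q r hl with h | h
  · left
    refine ⟨(F (p, 0)).2, fun x => ?_⟩
    refine hM.induction_isLine hconn (P := fun x => ∀ i, (F (x, i)).2 = (F (p, 0)).2 + i) ?_
      (fun i => (h i).1) x
    intro a b c hl ha
    have ha0 := ha 0
    rw [add_zero] at ha0
    rcases key a b c hl with h' | h'
    -- Both behaviours cannot meet at `a`: comparing levels at indices 0 and 1 would give 1 = 0.
    · intro i
      rw [(h' i).2, ha0]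
    · have := (h' 1).1
      rw [ha, ha0] at this
      exact absurd (add_eq_left.1 this) e1
  · right
    intro x
    refine hM.induction_isLine hconn (P := fun x => ∀ i, (F (x, i)).2 = (F (x, 0)).2) ?_
      (fun i => (h i).1) x
    intro a b c hl ha
    rcases key a b c hl with h' | h'
    · have := (h' 1).1
      rw [ha] at this
      exact absurd (left_eq_add.1 this) e1
    · exact fun i => (h' i).2

lemma weave_fst_ne (hM : M.IsPSTS) {F : Equiv.Perm (S × ZMod m)} (hF : F ∈ (M.weave m).Aut)
    {a b c : S} (hl : M.IsLine a b c) (i : ZMod m) : (F (a, i)).1 ≠ (F (b, i)).1 := by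
  rw [weave_mem_aut_iff] at hF
  exact hM.ne (hM.isLine_weave_iff.1 ((hF _ _ _).2 (isLine_weave_of_mem
    (p := (a, i)) (q := (b, i)) (r := (c, i + 1)) hl (by simp [weights])))).1

/-- An automorphism that maps every fibre into one level produces a cycle of inscribed
triangles. -/
lemma not_aut_fibre_to_level (hm : 3 < m) (hM : M.IsPSTS) (hconn : M.IsConnected)
    (hex : ∀ p, ∃ q r, M.IsLine p q r) (hanti : M.IsAntiPolypappian m)
    {F : Equiv.Perm (S × ZMod m)} (hF : F ∈ (M.weave m).Aut)
    (h : ∀ x i, (F (x, i)).2 = (F (x, 0)).2) : False := by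
  have e1 : (1 : ZMod m) ≠ 0 := by
    exact_mod_cast natCast_ne_zero_of_lt (m := m) (k := 1) (by omega) (by omega)
  obtain ⟨p⟩ := hconn.nonempty
  have hinv : ∀ y j, (F⁻¹ (y, j)).2 = (F⁻¹ (y, 0)).2 := by
    rcases aut_level_alternative hm hM hconn hex (inv_mem hF) with ⟨u, hu⟩ | h'
    · have hlev : ∀ i, i = u + (F (p, 0)).2 := by
        intro i
        have := hu (F (p, i)).1 (F (p, i)).2
        rw [Prod.mk.eta, Equiv.Perm.inv_def, Equiv.symm_apply_apply, h p i] at this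
        exact this
      exact absurd ((hlev 1).trans (hlev 0).symm) e1
    · exact h'
  obtain ⟨q, r, hl⟩ := hex p
  obtain ⟨l, hl⟩ := hl.exists_param
  refine (hanti m (by omega)).1 dvd_rfl
    (contains_cyclicTriangles (by omega) (fun p => (F (l p.1, p.2)).1) ?_ ?_)
  · rintro ⟨x, i⟩ ⟨y, j⟩ hxy
    simp only at hxy
    -- The first coordinate of an image already determines the original level, since F⁻¹ sends each
    -- fibre into one level.
    have hlev : ∀ z k, k = (F⁻¹ ((F (z, k)).1, 0)).2 := by
      intro z k
      rw [← hinv _ (F (z, k)).2, Prod.mk.eta, Equiv.Perm.inv_def, Equiv.symm_apply_apply]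
    have hij : i = j := by
      rw [hlev (l x) i, hxy, ← hlev (l y) j]
    subst hij
    by_cases hne : x = y
    · rw [hne]
    · obtain ⟨z, hz⟩ := exists_triangle_eq_univ x y hne
      exact absurd hxy (weave_fst_ne hM hF (hl x y z hz) i)
  · intro i a b c habc
    rw [weave_mem_aut_iff] at hF
    exact (hM.isLine_weave_iff.1 ((hF _ _ _).2 (isLine_weave_of_mem
      (p := (l a, i)) (q := (l b, i)) (r := (l c, i + 1)) (hl a b c habc) (by simp [weights])))).1

lemma aut_eq_prodCongr (hm : 3 < m) (hM : M.IsPSTS) (hconn : M.IsConnected)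
    (hex : ∀ p, ∃ q r, M.IsLine p q r) (hanti : M.IsAntiPolypappian m)
    {F : Equiv.Perm (S × ZMod m)} (hF : F ∈ (M.weave m).Aut) :
    ∃ f ∈ M.Aut, ∃ u : ZMod m, F = Equiv.prodCongr f (Equiv.addRight u) := by
  rcases aut_level_alternative hm hM hconn hex hF with ⟨u, hu⟩ | h
  swap
  · exact (not_aut_fibre_to_level hm hM hconn hex hanti hF h).elim
  rw [weave_mem_aut_iff] at hF
  have hbij : ∀ i, Function.Bijective fun x => (F (x, i)).1 := by
    intro i
    constructor
    · intro x y hxy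
      have : F (x, i) = F (y, i) := Prod.ext hxy (by rw [hu, hu])
      exact congrArg Prod.fst (F.injective this)
    · intro y
      obtain ⟨⟨x, j⟩, hx⟩ := F.surjective (y, u + i)
      have hj := hu x j
      rw [hx] at hj
      obtain rfl : i = j := add_left_cancel hj
      exact ⟨x, congrArg Prod.fst hx⟩
  let f : ZMod m → Equiv.Perm S := fun i => Equiv.ofBijective _ (hbij i)
  have hfF : ∀ x i, F (x, i) = (f i x, u + i) := fun x i => Prod.ext rfl (hu x i)
  have hf : ∀ i a b c, M.IsLine (f i a) (f i b) (f (i + 1) c) ↔ M.IsLine a b c := by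
    intro i a b c
    have := hF (a, i) (b, i) (c, i + 1)
    rw [hM.isLine_weave_iff, hM.isLine_weave_iff, hfF, hfF, hfF] at this
    simpa [weights, ← add_assoc] using this
  have hconst := levels_constant hm hM hconn hex hanti hf
  refine ⟨f 0, ?_, u, ?_⟩
  · rw [hM.mem_aut_iff]
    intro a b c
    have := hf 0 a b c
    rwa [hconst (0 + 1)] at this
  · ext1 ⟨x, i⟩
    rw [hfF, hconst i]
    simp [add_comm]

/-- The product action of `Aut M` and `C_m` on the points of the weaved configuration. -/
def prodAction (m : ℕ) (M : PointLineStructure S) :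
    M.Aut × Multiplicative (ZMod m) →* Equiv.Perm (S × ZMod m) where
  toFun p := Equiv.prodCongr (p.1 : Equiv.Perm S) (Equiv.addRight (p.2.toAdd))
  map_one' := by
    ext1 ⟨x, i⟩
    simp
  map_mul' p q := by
    ext1 ⟨x, i⟩
    simp [add_comm, add_left_comm]

lemma prodAction_injective [Nonempty S] : Function.Injective (prodAction m M) := by
  rintro ⟨f, u⟩ ⟨g, v⟩ h
  have h' : ∀ x i, (f.1 x, i + u.toAdd) = (g.1 x, i + v.toAdd) := fun x i =>
    congrArg (fun E : Equiv.Perm (S × ZMod m) => E (x, i)) h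
  refine Prod.ext (Subtype.ext (Equiv.ext fun x => congrArg Prod.fst (h' x 0))) ?_
  obtain ⟨x⟩ := ‹Nonempty S›
  exact Multiplicative.toAdd.injective (add_left_cancel (congrArg Prod.snd (h' x 0)))

end Weave

end PointLineStructure

end Weaving

theorem mainTheorem1 {S : Type*} (m : ℕ) (hm : 3 < m)
    (M : Weaving.PointLineStructure S) (hM : M.IsPSTS) (hconn : M.IsConnected)
    (hdeg : ∀ p : S, 1 < M.degree p) (hanti : M.IsAntiPolypappian m) :
    ((M.weave m).Aut : Set (Equiv.Perm (S × ZMod m))) =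
        {F | ∃ f ∈ M.Aut, ∃ u : ZMod m, F = Equiv.prodCongr f (Equiv.addRight u)} ∧
      Nonempty ((M.weave m).Aut ≃* M.Aut × Multiplicative (ZMod m)) := by
  have hex := hM.exists_isLine hdeg
  have hset : ((M.weave m).Aut : Set (Equiv.Perm (S × ZMod m))) =
      {F | ∃ f ∈ M.Aut, ∃ u : ZMod m, F = Equiv.prodCongr f (Equiv.addRight u)} := by
    ext F
    constructor
    · exact fun hF => Weaving.PointLineStructure.aut_eq_prodCongr hm hM hconn hex hanti hF
    · rintro ⟨f, hf, u, rfl⟩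
      exact Weaving.PointLineStructure.prodCongr_mem_aut hM hf u
  refine ⟨hset, ?_⟩
  have := hconn.nonempty
  have hrange : (Weaving.PointLineStructure.prodAction m M).range = (M.weave m).Aut := by
    apply SetLike.coe_injective
    rw [hset]
    ext F
    constructor
    · rintro ⟨⟨f, u⟩, rfl⟩
      exact ⟨f, f.2, u.toAdd, rfl⟩
    · rintro ⟨f, hf, u, rfl⟩
      exact ⟨(⟨f, hf⟩, Multiplicative.ofAdd u), rfl⟩
  exact ⟨((MonoidHom.ofInjective Weaving.PointLineStructure.prodAction_injective).trans
    (MulEquiv.subgroupCongr hrange)).symm⟩
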